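/- Let $n\ge 1$ and let $A=(a_{ij})$ be an $n\times n$ real nonnegative irreducible matrix, i.e. the digraph $D_A$ on $\{1,\dots,n\}$ with an arc $(i,j)$ whenever $a_{ij}\neq 0$ has, for all vertices $i,j$, a path of positive length from $i$ to $j$ (so the $1\times1$ zero matrix is excluded). Let $p\ge 1$ be the period of $A$, i.e. the greatest common divisor of the lengths of the closed paths of $D_A$. For a real square matrix $M$ let $sp(M)$ denote the multiset of its complex eigenvalues, counted with algebraic multiplicity, and let $|M|$ be the matrix of absolute values of its entries. A signing of $A$ is a real matrix $B$ with $|B|=A$. For $\alpha\in\mathbb{C}$ with $|\alpha|=1$ let $\mathcal{M}(\alpha,A)$ be the set of all signings $B$ of $A$ with $sp(B)=\alpha\, sp(A)$, as multisets. Two real matrices $M,N$ are $\{-1,1\}$-diagonally similar if $N=\Lambda^{-1}M\Lambda$ for some diagonal matrix $\Lambda$ with all diagonal entries in $\{-1,1\}$. Then: (i) For every $\alpha\in\mathbb{C}$ with $|\alpha|=1$, $\mathcal{M}(\alpha,A)$ is nonempty if and only if $\alpha=e^{i\pi k/p}$ for some $k\in\{0,\dots,2p-1\}$. (ii) Let $k\in\{0,\dots,2p-1\}$.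 (a) If $k$ is even, then $\mathcal{M}(e^{i\pi k/p},A)$ is the set of all matrices $\{-1,1\}$-diagonally similar to $A$. (b) If $k$ is odd, then for every signing $B_0$ of $A$ with $sp(B_0)=e^{i\pi/p}\,sp(A)$, $\mathcal{M}(e^{i\pi k/p},A)$ is the set of all matrices $\{-1,1\}$-diagonally similar to $B_0$. -/

import Mathlib

namespace SigningSpectra

/-- The period of a nonnegative matrix `A`: the greatest common divisor of the lengths of the
closed paths of its digraph `A.toQuiver` (an arc `i ⟶ j` for each entry `0 < A i j`), taken
literally as the largest natural number dividing all these lengths.  (Paths of length `0` are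
allowed; they are divisible by everything and do not matter.) -/
noncomputable def period {n : Type*} (A : Matrix n n ℝ) : ℕ :=
  letI := A.toQuiver
  sSup {d : ℕ | ∀ (i : n) (c : Quiver.Path i i), d ∣ c.length}

/-- The spectrum of a real matrix: the multiset of its complex eigenvalues, each counted with its
algebraic multiplicity. -/
noncomputable def sp {n : Type*} [Fintype n] [DecidableEq n] (A : Matrix n n ℝ) : Multiset ℂ :=
  (A.map Complex.ofReal).charpoly.roots

/-- `B` is a signing of `A` if `|B| = A`, with the absolute value taken entrywise. -/
def IsSigning {n : Type*} (A B : Matrix n n ℝ) : Prop :=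
  B.map (fun x => |x|) = A

/-- The set `M(α, A)` of all signings `B` of `A` such that `sp(B) = α sp(A)` as multisets. -/
def signingSet {n : Type*} [Fintype n] [DecidableEq n] (α : ℂ) (A : Matrix n n ℝ) :
    Set (Matrix n n ℝ) :=
  {B | IsSigning A B ∧ sp B = (sp A).map (fun z => α * z)}

/-- `A` and `B` are `{-1, 1}`-diagonally similar: `B = Λ⁻¹ A Λ` for a diagonal matrix `Λ` with
diagonal entries in `{-1, 1}`. -/
def SignDiagSimilar {n : Type*} [Fintype n] [DecidableEq n] (A B : Matrix n n ℝ) : Prop :=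
  ∃ d : n → ℝ, (∀ i, d i ∈ ({-1, 1} : Set ℝ)) ∧
    B = (Matrix.diagonal d)⁻¹ * A * Matrix.diagonal d

end SigningSpectra

/-! If `sp B = α sp A`, then `tr (B ^ m) = α ^ m tr (A ^ m)` for every `m`. Since `|B ^ m| ≤ A ^ m`
entrywise, the triangle inequality is tight along every closed path, so the product of the entries
of `B` along a closed path `c` is `α ^ |c|` times that of `A` (Wielandt's argument). These products
determine a signing up to `{-1, 1}`-diagonal similarity, because on a strongly connected digraph
weights that are trivial on closed paths are a coboundary. The products are
real, hence `α ^ (2p) = 1`.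

Conversely, if `α ^ (2p) = 1`, the constant weight `α ^ 2` is trivial on closed paths, hence a
coboundary of some `d`; conjugating `α A` by square roots of the `d i` gives a real signing of `A`.
In the same way `α A` is diagonally similar to `A` when `α ^ p = 1`, so `M(α, A)` depends only on
`α ^ p`. -/

namespace SigningSpectra

open Quiver Quiver.Path Matrix Polynomial

section Charpoly

variable {n : Type*} [Fintype n] [DecidableEq n]

section AlgClosed

variable {K : Type*} [Field K] [IsAlgClosed K]

theorem card_roots_charpoly (M : Matrix n n K) : M.charpoly.roots.card = Fintype.card n := by
  rw [← (IsAlgClosed.splits M.charpoly).natDegree_eq_card_roots, charpoly_natDegree_eq_dim]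

theorem eval_charpoly_eq_prod_roots (M : Matrix n n K) (z : K) :
    M.charpoly.eval z = (M.charpoly.roots.map fun r => z - r).prod :=
  (IsAlgClosed.splits _).eval_eq_prod_roots_of_monic M.charpoly_monic z

theorem det_aeval_eq_prod_roots_charpoly (M : Matrix n n K) (q : K[X]) :
    (aeval M q).det = (M.charpoly.roots.map fun r => q.eval r).prod := by
  have hq : q.Splits := IsAlgClosed.splits q
  induction hq using Submonoid.closure_induction with
  | one => simp
  | mul p q _ _ hp hq => simp [hp, hq]
  | mem q hq =>
    rcases hq with ⟨a, rfl⟩ | ⟨a, rfl⟩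
    · simp [Algebra.algebraMap_eq_smul_one, card_roots_charpoly]
    · have hM : aeval M (X + C a) = -(scalar n (-a) - M) := by
        simp [algebraMap_eq_diagonal, ← diagonal_neg]
      rw [hM, det_neg, ← eval_charpoly, eval_charpoly_eq_prod_roots, ← card_roots_charpoly M,
        ← Multiset.card_map (fun r => -a - r), ← Multiset.prod_map_neg]
      simp [add_comm]

theorem roots_charpoly_aeval (M : Matrix n n K) (q : K[X]) :
    (aeval M q).charpoly.roots = M.charpoly.roots.map fun r => q.eval r := by
  have hcharpoly : (aeval M q).charpoly =
      ((M.charpoly.roots.map fun r => q.eval r).map fun r => X - C r).prod := by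
    refine Polynomial.funext fun z => ?_
    have hz : scalar n z - aeval M q = aeval M (C z - q) := by
      simp [algebraMap_eq_diagonal]
    rw [eval_charpoly, hz, det_aeval_eq_prod_roots_charpoly]
    simp [eval_multiset_prod]
  rw [hcharpoly, roots_multiset_prod_X_sub_C]

theorem roots_charpoly_smul (a : K) (M : Matrix n n K) :
    (a • M).charpoly.roots = M.charpoly.roots.map (a * ·) := by
  have ha : aeval M (C a * X) = a • M := by rw [← smul_eq_C_mul, map_smul, aeval_X]
  rw [← ha, roots_charpoly_aeval]
  simp only [eval_C_mul, eval_X]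

theorem trace_pow_eq_sum_roots_charpoly (M : Matrix n n K) (m : ℕ) :
    (M ^ m).trace = (M.charpoly.roots.map (· ^ m)).sum := by
  simpa [trace_eq_sum_roots_charpoly] using congrArg Multiset.sum (roots_charpoly_aeval M (X ^ m))

end AlgClosed

theorem charpoly_eq_of_diagonal_conj {R : Type*} [CommRing R] {M N : Matrix n n R} (d : n → Rˣ)
    (h : ∀ i j, d i * M i j = N i j * d j) : N.charpoly = M.charpoly := by
  let D : (Matrix n n R)ˣ :=
    ⟨diagonal fun i => (d i : R), diagonal fun i => ((d i)⁻¹ : Rˣ),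
      by simp [diagonal_mul_diagonal], by simp [diagonal_mul_diagonal]⟩
  have hN : N = D.val * M * D⁻¹.val := by
    rw [Units.eq_mul_inv_iff_mul_eq]
    ext i j
    simp [D, mul_diagonal, diagonal_mul, h]
  rw [hN, coe_units_inv, charpoly_units_conj]

theorem sp_eq_map_mul_of_diagonal_conj {A B : Matrix n n ℝ} {α : ℂ} (d : n → ℂˣ)
    (h : ∀ i j, d i * (α * A i j) = B i j * d j) : sp B = (sp A).map (fun z => α * z) := by
  rw [sp, sp, ← roots_charpoly_smul]
  exact congrArg roots (charpoly_eq_of_diagonal_conj d h)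

theorem trace_pow_of_sp_eq_map_mul {A B : Matrix n n ℝ} {α : ℂ}
    (h : sp B = (sp A).map (fun z => α * z)) (m : ℕ) :
    ((B.map Complex.ofReal) ^ m).trace = α ^ m * ((A ^ m).trace : ℝ) := by
  have hA : (((A ^ m).trace : ℝ) : ℂ) = ((A.map Complex.ofReal) ^ m).trace := by
    rw [← Complex.ofRealHom_eq_coe, AddMonoidHom.map_trace, Matrix.map_pow]
    rfl
  rw [hA, trace_pow_eq_sum_roots_charpoly, trace_pow_eq_sum_roots_charpoly, ← sp, ← sp, h,
    ← Multiset.sum_map_mul_left]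
  simp only [Multiset.map_map, Function.comp_apply, mul_pow]

end Charpoly

section Weight

variable {V : Type*} [Quiver V]

theorem weightOfEPs_const {M : Type*} [Monoid M] (a : M) {i j : V} (c : Path i j) :
    weightOfEPs (fun _ _ => a) c = a ^ c.length := by
  induction c with
  | nil => rw [weightOfEPs_nil, length_nil, pow_zero]
  | cons c e ih => rw [weightOfEPs_cons, ih, length_cons, pow_succ]

theorem weightOfEPs_div {M : Type*} [DivisionCommMonoid M] (w w' : V → V → M) {i j : V}
    (c : Path i j) :
    weightOfEPs (fun i j => w i j / w' i j) c = weightOfEPs w c / weightOfEPs w' c := by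
  induction c with
  | nil => simp only [weightOfEPs_nil, div_one]
  | cons c e ih => simp only [weightOfEPs_cons, ih, div_mul_div_comm]

theorem exists_units_mul_eq_of_weightOfEPs_closed_eq_one {M : Type*} [Monoid M]
    (hV : IsStronglyConnected V) {w : V → V → M}
    (hw : ∀ (i : V) (c : Path i i), weightOfEPs w c = 1) :
    ∃ d : V → Mˣ, ∀ ⦃i j : V⦄, (i ⟶ j) → d i * w i j = d j := by
  obtain _ | ⟨⟨r⟩⟩ := isEmpty_or_nonempty V
  · exact ⟨isEmptyElim, fun i => isEmptyElim i⟩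
  let P (i : V) : Path r i := (hV r i).some
  let Q (i : V) : Path i r := (hV i r).some
  refine ⟨fun i => ⟨weightOfEPs w (P i), weightOfEPs w (Q i), ?_, ?_⟩, fun i j e => ?_⟩
  · rw [← weightOfEPs_comp, hw]
  · rw [← weightOfEPs_comp, hw]
  · have hQP : weightOfEPs w (Q j) * weightOfEPs w (P j) = 1 := by
      rw [← weightOfEPs_comp, hw]
    have hPQ : weightOfEPs w (P i) * w i j * weightOfEPs w (Q j) = 1 := by
      rw [← weightOfEPs_cons w (P i) e, ← weightOfEPs_comp, hw]
    exact left_inv_eq_right_inv hPQ hQP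

end Weight

section PathWeight

variable {n R : Type*} [Quiver n]

/-- The product of the entries of a matrix along a path, the invariant by which signings are
compared. The quiver need not be the digraph of the matrix, so that a matrix and its signings can be
evaluated on the same path. -/
def pathWeight [Monoid R] (M : Matrix n n R) {i j : n} (c : Path i j) : R :=
  weightOfEPs (fun i j => M i j) c

theorem pathWeight_nil [Monoid R] (M : Matrix n n R) (i : n) :
    pathWeight M (nil : Path i i) = 1 :=
  weightOfEPs_nil _ i

theorem pathWeight_cons [Monoid R] (M : Matrix n n R) {i j k : n} (c : Path i j) (e : j ⟶ k) :
    pathWeight M (c.cons e) = pathWeight M c * M j k :=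
  weightOfEPs_cons _ c e

theorem pathWeight_map {S F : Type*} [Monoid R] [Monoid S] [FunLike F R S]
    [MonoidHomClass F R S] (f : F) (M : Matrix n n R) {i j : n} (c : Path i j) :
    pathWeight (M.map f) c = f (pathWeight M c) := by
  induction c with
  | nil => rw [pathWeight_nil, pathWeight_nil, map_one]
  | cons c e ih => rw [pathWeight_cons, pathWeight_cons, ih, map_mul, map_apply]

theorem norm_pathWeight_le {A : Matrix n n ℝ} [NormedDivisionRing R] {B : Matrix n n R}
    (hAB : ∀ i j, ‖B i j‖ ≤ A i j) {i j : n} (c : Path i j) :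
    ‖pathWeight B c‖ ≤ pathWeight A c := by
  induction c with
  | nil => rw [pathWeight_nil, pathWeight_nil, norm_one]
  | cons c e ih =>
    rw [pathWeight_cons, pathWeight_cons, norm_mul]
    exact mul_le_mul ih (hAB _ _) (norm_nonneg _) ((norm_nonneg _).trans ih)

end PathWeight

theorem pathWeight_toQuiver_pos {n R : Type*} [Ring R] [LinearOrder R] [IsStrictOrderedRing R]
    (A : Matrix n n R) {i j : n} (c : @Path n A.toQuiver i j) :
    letI := A.toQuiver
    0 < pathWeight A c := by
  let := A.toQuiver
  exact weight_pos (w := fun {i j} (_ : i ⟶ j) => A i j) PLift.down c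

section Domination

variable {n 𝕜 : Type*} [Fintype n] [DecidableEq n] [RCLike 𝕜]
  {A : Matrix n n ℝ} {B : Matrix n n 𝕜}

theorem norm_pow_apply_le (hAB : ∀ i j, ‖B i j‖ ≤ A i j) (m : ℕ) (i j : n) :
    ‖(B ^ m) i j‖ ≤ (A ^ m) i j := by
  induction m generalizing j with
  | zero => by_cases hij : i = j <;> simp [hij]
  | succ m ih =>
    rw [pow_succ, pow_succ, mul_apply, mul_apply]
    refine norm_sum_le_of_le _ fun l _ => ?_
    rw [norm_mul]
    exact mul_le_mul (ih l) (hAB l j) (norm_nonneg _) ((norm_nonneg _).trans (ih l))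

theorem re_mul_le_of_norm_le_one {ζ z : 𝕜} {r : ℝ} (hζ : ‖ζ‖ ≤ 1) (hz : ‖z‖ ≤ r) :
    RCLike.re (ζ * z) ≤ r :=
  calc RCLike.re (ζ * z) ≤ ‖ζ‖ * ‖z‖ := norm_mul ζ z ▸ RCLike.re_le_norm _
    _ ≤ ‖z‖ := mul_le_of_le_one_left (norm_nonneg _) hζ
    _ ≤ r := hz

theorem exists_norm_le_one_eq_mul_ofReal {z : 𝕜} {r : ℝ} (hz : ‖z‖ ≤ r) :
    ∃ s : 𝕜, ‖s‖ ≤ 1 ∧ z = s * r := by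
  obtain rfl | hr := eq_or_ne r 0
  · exact ⟨0, by simp, by simpa using hz⟩
  · refine ⟨z / r, ?_, (div_mul_cancel₀ z (mod_cast hr)).symm⟩
    rw [norm_div, RCLike.norm_ofReal]
    exact div_le_one_of_le₀ (hz.trans (le_abs_self r)) (abs_nonneg r)

theorem eq_mul_of_norm_le_of_le_re {ζ z : 𝕜} {r : ℝ} (hζ : ‖ζ‖ = 1) (hz : ‖z‖ ≤ r)
    (hr : r ≤ RCLike.re (star ζ * z)) : z = ζ * r := by
  have hstar : ‖star ζ * z‖ = ‖z‖ := by rw [norm_mul, norm_star, hζ, one_mul]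
  have hreal : star ζ * z = ‖z‖ := by
    rw [← hstar]
    exact RCLike.norm_le_re_iff_eq_norm.1 (by rw [hstar]; exact hz.trans hr)
  have hnorm : ‖z‖ = r := le_antisymm hz (by rwa [hreal, RCLike.ofReal_re] at hr)
  have hζζ : ζ * star ζ = 1 := by simpa [hζ] using RCLike.mul_conj ζ
  rw [← hnorm, ← hreal, ← mul_assoc, hζζ, one_mul]

variable [Quiver n]

-- `ζ` ranges over the whole unit disc so that the induction can absorb into it the ratio of the
-- last entries of `B` and `A` along the path.
theorem pathWeight_sub_re_le (hAB : ∀ i j, ‖B i j‖ ≤ A i j) {i j : n} (c : Path i j) {ζ : 𝕜}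
    (hζ : ‖ζ‖ ≤ 1) :
    pathWeight A c - RCLike.re (ζ * pathWeight B c) ≤
      (A ^ c.length) i j - RCLike.re (ζ * (B ^ c.length) i j) := by
  induction c generalizing ζ with
  | nil => simp [pathWeight_nil]
  | @cons l j c e ih =>
    obtain ⟨s, hs, hB⟩ := exists_norm_le_one_eq_mul_ofReal (hAB l j)
    have hA : 0 ≤ A l j := (norm_nonneg _).trans (hAB l j)
    have hre (x : 𝕜) : RCLike.re (ζ * (x * B l j)) = RCLike.re (ζ * s * x) * A l j := by
      rw [hB, ← RCLike.re_mul_ofReal]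
      ring_nf
    have hnonneg (k : n) :
        0 ≤ (A ^ c.length) i k * A k j - RCLike.re (ζ * ((B ^ c.length) i k * B k j)) := by
      have hk := norm_pow_apply_le hAB c.length i k
      refine sub_nonneg.2 (re_mul_le_of_norm_le_one hζ ?_)
      rw [norm_mul]
      exact mul_le_mul hk (hAB k j) (norm_nonneg _) ((norm_nonneg _).trans hk)
    calc pathWeight A (c.cons e) - RCLike.re (ζ * pathWeight B (c.cons e))
        = (pathWeight A c - RCLike.re (ζ * s * pathWeight B c)) * A l j := by
          rw [pathWeight_cons, pathWeight_cons, hre, sub_mul]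
      _ ≤ ((A ^ c.length) i l - RCLike.re (ζ * s * (B ^ c.length) i l)) * A l j := by
          refine mul_le_mul_of_nonneg_right (ih ?_) hA
          rw [norm_mul]
          exact mul_le_one₀ hζ (norm_nonneg s) hs
      _ = (A ^ c.length) i l * A l j - RCLike.re (ζ * ((B ^ c.length) i l * B l j)) := by
          rw [hre, sub_mul]
      _ ≤ ∑ k, ((A ^ c.length) i k * A k j - RCLike.re (ζ * ((B ^ c.length) i k * B k j))) :=
          Finset.single_le_sum (fun k _ => hnonneg k) (Finset.mem_univ l)
      _ = (A ^ (c.cons e).length) i j - RCLike.re (ζ * (B ^ (c.cons e).length) i j) := by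
          rw [length_cons, pow_succ, pow_succ, mul_apply, mul_apply, Finset.mul_sum, map_sum,
            Finset.sum_sub_distrib]

theorem pathWeight_eq_mul_of_trace_pow_eq_mul (hAB : ∀ i j, ‖B i j‖ ≤ A i j) {i : n}
    (c : Path i i) {ζ : 𝕜} (hζ : ‖ζ‖ = 1)
    (htrace : (B ^ c.length).trace = ζ * ((A ^ c.length).trace : ℝ)) :
    pathWeight B c = ζ * (pathWeight A c : ℝ) := by
  have hstar : ‖star ζ‖ ≤ 1 := by rw [norm_star, hζ]
  refine eq_mul_of_norm_le_of_le_re hζ (norm_pathWeight_le hAB c) (sub_nonpos.1 ?_)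
  calc pathWeight A c - RCLike.re (star ζ * pathWeight B c)
      ≤ (A ^ c.length) i i - RCLike.re (star ζ * (B ^ c.length) i i) :=
        pathWeight_sub_re_le hAB c hstar
    _ ≤ ∑ k, ((A ^ c.length) k k - RCLike.re (star ζ * (B ^ c.length) k k)) :=
        Finset.single_le_sum (fun k _ => sub_nonneg.2 <|
          re_mul_le_of_norm_le_one hstar (norm_pow_apply_le hAB _ k k)) (Finset.mem_univ i)
    _ = (A ^ c.length).trace - RCLike.re (star ζ * (B ^ c.length).trace) := by
        simp only [trace, diag_apply, Finset.mul_sum, map_sum, Finset.sum_sub_distrib]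
    _ = 0 := by
        have hζζ : star ζ * ζ = 1 := by simpa [hζ] using RCLike.conj_mul ζ
        rw [htrace, ← mul_assoc, hζζ, one_mul, RCLike.ofReal_re, sub_self]

end Domination

section Period

theorem dvd_sSup_commonDivisors_iff {ι : Type*} {f : ι → ℕ} {i₀ : ι} (h₀ : f i₀ ≠ 0) {d : ℕ} :
    d ∣ sSup {e | ∀ i, e ∣ f i} ↔ ∀ i, d ∣ f i := by
  set D : Set ℕ := {e | ∀ i, e ∣ f i}
  have hbdd : BddAbove D := ⟨f i₀, fun e he => Nat.le_of_dvd (Nat.pos_of_ne_zero h₀) (he i₀)⟩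
  have hmem : sSup D ∈ D := Nat.sSup_mem ⟨1, fun _ => one_dvd _⟩ hbdd
  refine ⟨fun hd i => hd.trans (hmem i), fun hd => ?_⟩
  have hlcm : Nat.lcm d (sSup D) ∈ D := fun i => Nat.lcm_dvd (hd i) (hmem i)
  have hpos : 0 < Nat.lcm d (sSup D) := Nat.pos_of_dvd_of_pos (hlcm i₀) (Nat.pos_of_ne_zero h₀)
  have heq : Nat.lcm d (sSup D) = sSup D :=
    le_antisymm (le_csSup hbdd hlcm) (Nat.le_of_dvd hpos (Nat.dvd_lcm_right _ _))
  exact heq ▸ Nat.dvd_lcm_left d (sSup D)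

variable {n : Type*} [Nonempty n] {A : Matrix n n ℝ}

theorem dvd_period_iff (hA : A.IsIrreducible) {d : ℕ} :
    letI := A.toQuiver
    d ∣ period A ↔ ∀ (i : n) (c : Path i i), d ∣ c.length := by
  let := A.toQuiver
  obtain ⟨r⟩ := ‹Nonempty n›
  obtain ⟨c, hc⟩ := hA.connected r r
  have h := dvd_sSup_commonDivisors_iff (f := fun c : Σ i : n, Path i i => c.2.length)
    (i₀ := ⟨r, c⟩) hc.ne' (d := d)
  simpa only [period, Sigma.forall] using h

theorem period_ne_zero (hA : A.IsIrreducible) : period A ≠ 0 := by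
  let := A.toQuiver
  obtain ⟨r⟩ := ‹Nonempty n›
  obtain ⟨c, hc⟩ := hA.connected r r
  intro h0
  exact hc.ne' (zero_dvd_iff.1 ((dvd_period_iff hA).1 h0.symm.dvd r c))

theorem pow_period_eq_one_iff (hA : A.IsIrreducible) {M : Type*} [Monoid M] {a : M} :
    letI := A.toQuiver
    a ^ period A = 1 ↔ ∀ (i : n) (c : Path i i), a ^ c.length = 1 := by
  simp only [← orderOf_dvd_iff_pow_eq_one, dvd_period_iff hA]

theorem exists_units_mul_eq_of_pow_period_eq_one (hA : A.IsIrreducible) {M : Type*} [Monoid M]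
    {a : M} (ha : a ^ period A = 1) : ∃ d : n → Mˣ, ∀ i j, 0 < A i j → d i * a = d j := by
  let := A.toQuiver
  obtain ⟨d, hd⟩ := exists_units_mul_eq_of_weightOfEPs_closed_eq_one
    hA.connected.isStronglyConnected (w := fun _ _ => a) fun i c => by
      rw [weightOfEPs_const, (pow_period_eq_one_iff hA).1 ha]
  exact ⟨d, fun i j hij => hd ⟨hij⟩⟩

end Period

section Signing

variable {n : Type*} {A B C : Matrix n n ℝ}

theorem IsSigning.abs_apply (h : IsSigning A B) (i j : n) : |B i j| = A i j :=
  congrFun (congrFun h i) j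

theorem IsSigning.abs_pathWeight [Quiver n] (h : IsSigning A B) {i j : n} (c : Path i j) :
    |pathWeight B c| = pathWeight A c := by
  rw [← h]
  exact (pathWeight_map (absHom (α := ℝ)) B c).symm

variable [Fintype n] [DecidableEq n]

theorem signDiagSimilar_iff :
    SignDiagSimilar A B ↔ ∃ d : n → ℝ, (∀ i, |d i| = 1) ∧ ∀ i j, d i * A i j = B i j * d j := by
  refine exists_congr fun d => ?_
  have hd : (∀ i, d i ∈ ({-1, 1} : Set ℝ)) ↔ ∀ i, |d i| = 1 := by
    simp only [Set.mem_insert_iff, Set.mem_singleton_iff, abs_eq zero_le_one, or_comm]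
  rw [hd]
  refine and_congr_right fun habs => ?_
  have hsq (i : n) : d i * d i = 1 := by rw [← abs_mul_abs_self, habs, one_mul]
  have hmul : diagonal d * diagonal d = 1 := by simp [diagonal_mul_diagonal, hsq]
  have hmatrix : B = (diagonal d)⁻¹ * A * diagonal d ↔ diagonal d * A = B * diagonal d := by
    rw [inv_eq_left_inv hmul]
    constructor
    · rintro rfl
      rw [Matrix.mul_assoc _ (diagonal d) (diagonal d), hmul, Matrix.mul_one]
    · intro h
      rw [h, Matrix.mul_assoc, hmul, Matrix.mul_one]
  simp only [hmatrix, ← Matrix.ext_iff, diagonal_mul, mul_diagonal]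

theorem IsSigning.of_signDiagSimilar (h : IsSigning A B) (hBC : SignDiagSimilar B C) :
    IsSigning A C := by
  obtain ⟨d, hd, hC⟩ := signDiagSimilar_iff.1 hBC
  ext i j
  simpa [abs_mul, hd, h.abs_apply] using (congrArg abs (hC i j)).symm

theorem sp_eq_of_signDiagSimilar (h : SignDiagSimilar A B) : sp B = sp A := by
  obtain ⟨d, hd, hB⟩ := signDiagSimilar_iff.1 h
  have hd0 (i : n) : (d i : ℂ) ≠ 0 := by
    rw [Complex.ofReal_ne_zero, ← abs_ne_zero, hd]
    exact one_ne_zero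
  simpa using sp_eq_map_mul_of_diagonal_conj (α := 1) (fun i => Units.mk0 _ (hd0 i)) fun i j => by
    simp only [one_mul, Units.val_mk0]
    exact_mod_cast hB i j

theorem signDiagSimilar_of_pathWeight_closed_eq (hA : A.IsIrreducible)
    (hB : IsSigning A B) (hC : IsSigning A C)
    (h : letI := A.toQuiver; ∀ (i : n) (c : Path i i), pathWeight B c = pathWeight C c) :
    SignDiagSimilar B C := by
  let := A.toQuiver
  obtain ⟨d, hd⟩ := exists_units_mul_eq_of_weightOfEPs_closed_eq_one
    hA.connected.isStronglyConnected (w := fun i j => B i j / C i j) fun i c => by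
      have hCc : pathWeight C c ≠ 0 := by
        rw [← abs_ne_zero, hC.abs_pathWeight]
        exact (pathWeight_toQuiver_pos A c).ne'
      exact (weightOfEPs_div _ _ c).trans ((div_eq_one_iff_eq hCc).2 (h i c))
  refine signDiagSimilar_iff.2 ⟨fun i => d i / |(d i : ℝ)|, fun i => ?_, fun i j => ?_⟩
  · rw [abs_div, abs_abs, div_self (abs_ne_zero.2 (d i).ne_zero)]
  · obtain h0 | hpos := (hA.nonneg i j).eq_or_lt
    · have hB0 : B i j = 0 := by rw [← abs_eq_zero, hB.abs_apply, h0]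
      have hC0 : C i j = 0 := by rw [← abs_eq_zero, hC.abs_apply, h0]
      rw [hB0, hC0, mul_zero, zero_mul]
    · have hC0 : C i j ≠ 0 := by
        rw [← abs_ne_zero, hC.abs_apply]
        exact hpos.ne'
      have hdj : d i * (B i j / C i j) = (d j : ℝ) := hd ⟨hpos⟩
      have habs : |(d j : ℝ)| = |(d i : ℝ)| := by
        rw [← hdj, abs_mul, abs_div, hB.abs_apply, hC.abs_apply, div_self hpos.ne', mul_one]
      dsimp only
      rw [habs, ← hdj]
      field_simp

end Signing

section SigningSet

variable {n : Type*} [Fintype n] [DecidableEq n] {A B C : Matrix n n ℝ} {α β : ℂ}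

theorem self_mem_signingSet_one (hA : ∀ i j, 0 ≤ A i j) : A ∈ signingSet 1 A :=
  ⟨by ext i j; exact abs_of_nonneg (hA i j), by simp⟩

theorem pathWeight_closed_of_mem_signingSet [Quiver n] (hα : ‖α‖ = 1) (hB : B ∈ signingSet α A)
    {i : n} (c : Path i i) : ((pathWeight B c : ℝ) : ℂ) = α ^ c.length * (pathWeight A c : ℝ) := by
  have hAB (i j : n) : ‖(B.map Complex.ofReal) i j‖ ≤ A i j := by
    rw [map_apply, Complex.norm_real, Real.norm_eq_abs, hB.1.abs_apply]
  rw [← Complex.ofRealHom_eq_coe, ← pathWeight_map]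
  exact pathWeight_eq_mul_of_trace_pow_eq_mul hAB c (by rw [norm_pow, hα, one_pow])
    (trace_pow_of_sp_eq_map_mul hB.2 c.length)

theorem signingSet_eq_of_mem (hA : A.IsIrreducible) (hα : ‖α‖ = 1) (hB : B ∈ signingSet α A) :
    signingSet α A = {C | SignDiagSimilar B C} := by
  ext C
  refine ⟨fun hC => ?_, fun hBC => ⟨hB.1.of_signDiagSimilar hBC, ?_⟩⟩
  · let := A.toQuiver
    refine signDiagSimilar_of_pathWeight_closed_eq hA hB.1 hC.1 fun i c => ?_
    rw [← Complex.ofReal_inj, pathWeight_closed_of_mem_signingSet hα hB,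
      pathWeight_closed_of_mem_signingSet hα hC]
  · rw [sp_eq_of_signDiagSimilar hBC, hB.2]

variable [Nonempty n]

theorem sp_map_mul_eq_of_pow_period_eq_one (hA : A.IsIrreducible) (hα : α ^ period A = 1) :
    (sp A).map (fun z => α * z) = sp A := by
  obtain ⟨d, hd⟩ := exists_units_mul_eq_of_pow_period_eq_one hA hα
  refine (sp_eq_map_mul_of_diagonal_conj d fun i j => ?_).symm
  obtain h0 | hpos := (hA.nonneg i j).eq_or_lt
  · simp [← h0]
  · rw [← mul_assoc, hd i j hpos, mul_comm]

theorem signingSet_eq_of_pow_period_eq (hA : A.IsIrreducible)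
    (h : α ^ period A = β ^ period A) : signingSet α A = signingSet β A := by
  obtain rfl | hβ := eq_or_ne β 0
  · rw [zero_pow (period_ne_zero hA), pow_eq_zero_iff (period_ne_zero hA)] at h
    rw [h]
  have hω : (α / β) ^ period A = 1 := by rw [div_pow, h, div_self (pow_ne_zero _ hβ)]
  have hsp : (sp A).map (fun z => α * z) = (sp A).map (fun z => β * z) := by
    conv_rhs => rw [← sp_map_mul_eq_of_pow_period_eq_one hA hω]
    simp only [Multiset.map_map, Function.comp_apply, ← mul_assoc, mul_div_cancel₀ α hβ]
  simp only [signingSet, hsp]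

theorem pow_two_mul_period_eq_one_of_mem_signingSet (hA : A.IsIrreducible) (hα : ‖α‖ = 1)
    (hB : B ∈ signingSet α A) : α ^ (2 * period A) = 1 := by
  let := A.toQuiver
  rw [pow_mul, pow_period_eq_one_iff hA]
  intro i c
  have hpos : ((pathWeight A c : ℝ) : ℂ) ≠ 0 := mod_cast (pathWeight_toQuiver_pos A c).ne'
  have hsq : ((pathWeight B c : ℝ) : ℂ) ^ 2 = ((pathWeight A c : ℝ) : ℂ) ^ 2 := by
    rw [← hB.1.abs_pathWeight]
    exact_mod_cast (sq_abs (pathWeight B c)).symm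
  rw [pathWeight_closed_of_mem_signingSet hα hB, mul_pow, ← pow_mul, mul_comm c.length,
    pow_mul] at hsq
  exact mul_right_cancel₀ (pow_ne_zero 2 hpos) (hsq.trans (one_mul _).symm)

theorem signingSet_nonempty_of_pow_two_mul_period_eq_one (hA : A.IsIrreducible)
    (hα : α ^ (2 * period A) = 1) : (signingSet α A).Nonempty := by
  rw [pow_mul] at hα
  obtain ⟨d, hd⟩ := exists_units_mul_eq_of_pow_period_eq_one hA hα
  choose e he using fun i => IsAlgClosed.exists_eq_mul_self (d i : ℂ)
  have he0 (i : n) : e i ≠ 0 := fun h => (d i).ne_zero (by rw [he, h, mul_zero])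
  have hsign (i j : n) (hij : 0 < A i j) : α * e i / e j = 1 ∨ α * e i / e j = -1 := by
    rw [← sq_eq_one_iff, div_pow, div_eq_one_iff_eq (pow_ne_zero 2 (he0 j)), mul_pow, sq (e i),
      sq (e j), ← he, ← he, ← hd i j hij, mul_comm]
  refine ⟨of fun i j => (α * e i / e j).re * A i j, ?_, ?_⟩
  · ext i j
    obtain h0 | hpos := (hA.nonneg i j).eq_or_lt
    · simp [← h0]
    · obtain h | h := hsign i j hpos <;> simp [h, hpos.le]
  · refine sp_eq_map_mul_of_diagonal_conj (fun i => Units.mk0 (e i) (he0 i)) fun i j => ?_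
    obtain h0 | hpos := (hA.nonneg i j).eq_or_lt
    · simp [← h0]
    · have hreal : ((α * e i / e j).re : ℂ) = α * e i / e j := by
        obtain h | h := hsign i j hpos <;> simp [h]
      rw [of_apply, Complex.ofReal_mul, hreal, Units.val_mk0, Units.val_mk0]
      field_simp [he0 j]

theorem signingSet_nonempty_iff (hA : A.IsIrreducible) (hα : ‖α‖ = 1) :
    (signingSet α A).Nonempty ↔ α ^ (2 * period A) = 1 :=
  ⟨fun ⟨_, hB⟩ => pow_two_mul_period_eq_one_of_mem_signingSet hA hα hB,
    signingSet_nonempty_of_pow_two_mul_period_eq_one hA⟩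

end SigningSet

section RootsOfUnity

variable {p : ℕ}

theorem pow_eq_one_iff_exists_eq_exp (hp : p ≠ 0) {α : ℂ} :
    α ^ (2 * p) = 1 ↔
      ∃ k ∈ Finset.range (2 * p), α = Complex.exp (Complex.I * Real.pi * k / p) := by
  have hexp (k : ℕ) : Complex.exp (2 * Real.pi * Complex.I / (2 * p : ℕ)) ^ k =
      Complex.exp (Complex.I * Real.pi * k / p) := by
    rw [← Complex.exp_nat_mul]
    congr 1
    push_cast
    field_simp
  have hprim := Complex.isPrimitiveRoot_exp (2 * p) (mul_ne_zero two_ne_zero hp)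
  have : NeZero (2 * p) := ⟨mul_ne_zero two_ne_zero hp⟩
  constructor
  · intro hα
    obtain ⟨k, hk, rfl⟩ := hprim.eq_pow_of_pow_eq_one hα
    exact ⟨k, Finset.mem_range.2 hk, hexp k⟩
  · rintro ⟨k, -, rfl⟩
    rw [← hexp, ← pow_mul, mul_comm k, pow_mul, hprim.pow_eq_one, one_pow]

theorem exp_pi_mul_div_pow (hp : p ≠ 0) (k : ℕ) :
    Complex.exp (Complex.I * Real.pi * k / p) ^ p = (-1) ^ k := by
  rw [← Complex.exp_nat_mul, ← Complex.exp_pi_mul_I, ← Complex.exp_nat_mul]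
  congr 1
  field_simp

end RootsOfUnity

end SigningSpectra

open SigningSpectra

theorem theorem1 {n : Type*} [Fintype n] [DecidableEq n] [Nonempty n]
    (A : Matrix n n ℝ) (hA : A.IsIrreducible) (p : ℕ) (hp : SigningSpectra.period A = p) :
    (∀ α : ℂ, ‖α‖ = 1 →
      ((SigningSpectra.signingSet α A).Nonempty ↔
        ∃ k ∈ Finset.range (2 * p), α = Complex.exp (Complex.I * Real.pi * k / p))) ∧
    (∀ k ∈ Finset.range (2 * p),
      (Even k →
        SigningSpectra.signingSet (Complex.exp (Complex.I * Real.pi * k / p)) A =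
          {B | SigningSpectra.SignDiagSimilar A B}) ∧
      (Odd k →
        ∀ B₀ : Matrix n n ℝ, SigningSpectra.IsSigning A B₀ →
          SigningSpectra.sp B₀ =
            (SigningSpectra.sp A).map (fun z => Complex.exp (Complex.I * Real.pi / p) * z) →
          SigningSpectra.signingSet (Complex.exp (Complex.I * Real.pi * k / p)) A =
            {B | SigningSpectra.SignDiagSimilar B₀ B})) := by
  subst hp
  have hp := period_ne_zero hA
  refine ⟨fun α hα => (signingSet_nonempty_iff hA hα).trans (pow_eq_one_iff_exists_eq_exp hp),
    fun k _ => ⟨fun hk => ?_, fun hk B₀ hB₀ hsp => ?_⟩⟩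
  · rw [signingSet_eq_of_pow_period_eq hA (β := 1)
      (by rw [exp_pi_mul_div_pow hp, hk.neg_one_pow, one_pow])]
    exact signingSet_eq_of_mem hA norm_one (self_mem_signingSet_one hA.nonneg)
  · set β := Complex.exp (Complex.I * Real.pi / period A)
    have hβ : β ^ period A = -1 := by simpa using exp_pi_mul_div_pow hp 1
    have hnorm : ‖β‖ = 1 :=
      Complex.norm_eq_one_of_pow_eq_one (n := period A * 2) (by simp [pow_mul, hβ])
        (mul_ne_zero hp two_ne_zero)
    rw [signingSet_eq_of_pow_period_eq hA (β := β)
      (by rw [exp_pi_mul_div_pow hp, hk.neg_one_pow, hβ])]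
    exact signingSet_eq_of_mem hA hnorm ⟨hB₀, hsp⟩
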